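/- Let $k$ be a field. All algebras are $k$-algebras, homomorphisms and automorphisms are $k$-linear, $\otimes=\otimes_k$, modules are left modules, and $A^{e}=A\otimes A^{\circ}$ is the enveloping algebra of an algebra $A$, so that $A$ is an $A^e$-module and $A$-bimodules are $A^e$-modules. Dimensions take values in $\{-\infty\}\cup\mathbb N\cup\{\infty\}$, and for a ring $R$, $\operatorname{injdim}R$ is the injective dimension of $R$ as a module over itself. "Noetherian" means left and right noetherian. Put $$\operatorname{Htr}A=\operatorname{injdim}A^e,\qquad \operatorname{H_1tr}A=\sup\{i \mid \operatorname{Ext}^i_{A^e}(A,A^e)\neq 0\},$$ $$\operatorname{H_2tr}A=\sup_U\ \operatorname{injdim}(A\otimes U),\qquad \operatorname{H_3tr}A=\sup_{U:\ A\otimes U\text{ noetherian}}\operatorname{injdim}(A\otimes U),$$ where $U$ ranges over all division algebras over $k$ (respectively those for which $A\otimes U$ is noetherian). A simple artinian algebra $S$ is called *homologically uniform* if $\operatorname{Htr}S=\operatorname{H_1tr}S=\operatorname{H_2tr}S<\infty$, *smooth* if $\operatorname{pdim}_{S^e}S<\infty$, and *rigid* if there are an integer $n$ and an automorphism $\sigma$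 of $S$ such that $\operatorname{Ext}^n_{S^e}(S,S^e)\cong S^\sigma$ as bimodules and $\operatorname{Ext}^i_{S^e}(S,S^e)=0$ for $i\ne n$; here $S^\sigma$ is $S$ with $a*s*b=as\sigma(b)$. An algebra $A$ is *doubly noetherian* if $A^e$ is noetherian. **Proposition 7.1.** Let $F$ be a separable algebraic field extension of $k$ with $\dim_kF=\aleph_0$. Then: (a) $F$ is smooth and homologically uniform, and $\operatorname{Htr}F=\operatorname{gldim}F^e=1$. (b) $F$ is not doubly noetherian. Every subfield $G$ with $k\subseteq G\subseteq F$ and $\dim_kG<\infty$ has $\operatorname{Htr}G=0$; in particular the supremum of $\operatorname{Htr}G$ over all such $G$ is $0<1=\operatorname{Htr}F$. (c) $\operatorname{H_3tr}F=\operatorname{tr}F=0$, where $\operatorname{tr}$ is the transcendence degree over $k$. (d) $F$ is not rigid; moreover $\operatorname{Ext}^1_{F^e}(F,F^e)$ is infinite dimensional over $F$. -/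

import Mathlib

open CategoryTheory
open scoped TensorProduct

universe u v w

noncomputable section

namespace HomTr

/-! ### Rings and their homological dimensions

Dimensions take values in `WithBot ℕ∞`; the supremum of the empty set and the dimension of the zero
module are `⊥`, that is `-∞`. Modules are left modules. -/

/-- The injective dimension of a ring as a left module over itself. -/
def injdim (R : Type v) [Ring R] : WithBot ℕ∞ :=
  injectiveDimension (ModuleCat.of.{v} R R)

/-- The (left) global dimension of a ring. -/
def gldim (R : Type v) [Ring R] : WithBot ℕ∞ :=
  ⨆ M : ModuleCat.{v} R, projectiveDimension M

/-- A (two-sided) noetherian ring. -/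
def IsNoetherianBothSides (R : Type v) [Ring R] : Prop :=
  IsNoetherianRing R ∧ IsNoetherianRing Rᵐᵒᵖ

variable (k : Type u) [Field k] (A : Type v) [Ring A] [Algebra k A]

/-- The enveloping algebra `A ⊗ Aᵒᵖ`. -/
abbrev Env : Type v := A ⊗[k] Aᵐᵒᵖ

/-- The algebra `A` as a left module over its enveloping algebra: `(a ⊗ b) • s = a * s * b`. -/
def diagonal : ModuleCat.{v} (Env k A) :=
  letI : Module (Env k A) A := TensorProduct.Algebra.module
  ModuleCat.of (Env k A) A

/-- The enveloping algebra as a left module over itself. -/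
abbrev envSelf : ModuleCat.{v} (Env k A) := ModuleCat.of (Env k A) (Env k A)

/-! ### The bimodules `Extⁱ(A, A ⊗ Aᵒᵖ)` -/

/-- The switch `a ⊗ b ↦ b ⊗ a`, an anti-automorphism of the enveloping algebra. -/
def switch : Env k A →ₗ[k] Env k A :=
  TensorProduct.map (MulOpposite.opLinearEquiv k (M := A)).symm.toLinearMap
    (MulOpposite.opLinearEquiv k (M := A)).toLinearMap ∘ₗ
      (TensorProduct.comm k A Aᵐᵒᵖ).toLinearMap

@[simp] lemma switch_tmul (a : A) (b : Aᵐᵒᵖ) :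
    switch k A (a ⊗ₜ b) = b.unop ⊗ₜ MulOpposite.op a := rfl

lemma switch_one : switch k A 1 = 1 := rfl

lemma switch_mul (x y : Env k A) : switch k A (x * y) = switch k A y * switch k A x := by
  induction x using TensorProduct.induction_on with
  | zero => simp
  | add x x' hx hx' => simp [add_mul, mul_add, hx, hx']
  | tmul a b =>
    induction y using TensorProduct.induction_on with
    | zero => simp
    | add y y' hy hy' => simp [add_mul, mul_add, hy, hy']
    | tmul c d => simp

/-- Right multiplication by `r`, an endomorphism of the left module `A ⊗ Aᵒᵖ`. -/
def rightMul (r : Env k A) : envSelf k A ⟶ envSelf k A :=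
  ModuleCat.ofHom (LinearMap.toSpanSingleton (Env k A) (Env k A) r)

lemma rightMul_one : rightMul k A 1 = 𝟙 _ := by
  ext
  simp [rightMul]

lemma rightMul_mul (r s : Env k A) :
    rightMul k A (r * s) = rightMul k A r ≫ rightMul k A s := by
  ext
  simp [rightMul]

lemma rightMul_add (r s : Env k A) :
    rightMul k A (r + s) = rightMul k A r + rightMul k A s := by
  ext
  simp [rightMul]

lemma rightMul_zero : rightMul k A 0 = 0 := by
  ext
  simp [rightMul]

/-- The bimodule structure on `Extⁱ(A, A ⊗ Aᵒᵖ)`, `Ext` over `A ⊗ Aᵒᵖ`, that comes from the right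
multiplications of the second argument: `a • ξ • b` is the image of `ξ` under right multiplication
by `switch (a ⊗ b) = b ⊗ a`. -/
abbrev extModule (i : ℕ) :
    Module (Env k A) (Abelian.Ext (diagonal k A) (envSelf k A) i) where
  smul r ξ := ξ.comp (Abelian.Ext.mk₀ (rightMul k A (switch k A r))) (add_zero i)
  one_smul ξ := by
    change ξ.comp (Abelian.Ext.mk₀ (rightMul k A (switch k A 1))) (add_zero i) = ξ
    rw [switch_one, rightMul_one, Abelian.Ext.comp_mk₀_id]
  mul_smul r s ξ := by
    change ξ.comp (Abelian.Ext.mk₀ (rightMul k A (switch k A (r * s)))) (add_zero i) =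
      (ξ.comp (Abelian.Ext.mk₀ (rightMul k A (switch k A s))) (add_zero i)).comp
        (Abelian.Ext.mk₀ (rightMul k A (switch k A r))) (add_zero i)
    rw [switch_mul, rightMul_mul, ← Abelian.Ext.mk₀_comp_mk₀,
      Abelian.Ext.comp_assoc_of_second_deg_zero]
  smul_zero r := by
    change (0 : Abelian.Ext (diagonal k A) (envSelf k A) i).comp
      (Abelian.Ext.mk₀ (rightMul k A (switch k A r))) (add_zero i) = 0
    rw [Abelian.Ext.zero_comp]
  smul_add r ξ η := Abelian.Ext.add_comp _ _ _ _
  add_smul r s ξ := by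
    change ξ.comp (Abelian.Ext.mk₀ (rightMul k A (switch k A (r + s)))) (add_zero i) =
      ξ.comp (Abelian.Ext.mk₀ (rightMul k A (switch k A r))) (add_zero i) +
      ξ.comp (Abelian.Ext.mk₀ (rightMul k A (switch k A s))) (add_zero i)
    rw [map_add, rightMul_add, Abelian.Ext.mk₀_add, Abelian.Ext.comp_add]
  zero_smul ξ := by
    change ξ.comp (Abelian.Ext.mk₀ (rightMul k A (switch k A 0))) (add_zero i) = 0
    rw [map_zero, rightMul_zero, Abelian.Ext.mk₀_zero, Abelian.Ext.comp_zero]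

/-- `Extⁱ(A, A ⊗ Aᵒᵖ)` over `A ⊗ Aᵒᵖ`, as an `A`-bimodule. -/
def extBimodule (i : ℕ) : ModuleCat.{v} (Env k A) :=
  letI := extModule k A i
  ModuleCat.of (Env k A) (Abelian.Ext (diagonal k A) (envSelf k A) i)

/-- `Extⁱ(A, A ⊗ Aᵒᵖ)` as a left `A`-module. -/
def extLeftModule (i : ℕ) : ModuleCat.{v} A :=
  (ModuleCat.restrictScalars
    (Algebra.TensorProduct.includeLeft : A →ₐ[k] Env k A).toRingHom).obj (extBimodule k A i)

variable {A} in
/-- The bimodule `A^σ`: the group `A` with `(a ⊗ b) • s = a * s * σ b`. -/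
def twisted (σ : A ≃ₐ[k] A) : ModuleCat.{v} (Env k A) :=
  (ModuleCat.restrictScalars
    (Algebra.TensorProduct.map (AlgHom.id k A) (AlgHom.op σ.toAlgHom)).toRingHom).obj
      (diagonal k A)

/-! ### Homological transcendence degrees -/

/-- The homological transcendence degree. -/
def htr : WithBot ℕ∞ := injdim (Env k A)

/-- The first modification of `htr`. -/
def fhtr : WithBot ℕ∞ :=
  ⨆ (i : ℕ) (_ : Nontrivial (Abelian.Ext (diagonal k A) (envSelf k A) i)), (i : WithBot ℕ∞)

/-- The second modification of `htr`; the universe `w` bounds the division algebras `U`. -/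
def shtr : WithBot ℕ∞ :=
  ⨆ (U : Type w) (_ : DivisionRing U) (_ : Algebra k U), injdim (A ⊗[k] U)

/-- The third modification of `htr`; the universe `w` bounds the division algebras `U`. -/
def thtr : WithBot ℕ∞ :=
  ⨆ (U : Type w) (_ : DivisionRing U) (_ : Algebra k U)
    (_ : IsNoetherianBothSides (A ⊗[k] U)), injdim (A ⊗[k] U)

/-- An algebra is doubly noetherian if its enveloping algebra is noetherian. -/
def IsDoublyNoetherian : Prop := IsNoetherianBothSides (Env k A)

/-- Homologically uniform simple artinian algebras. -/
def IsHomologicallyUniform [IsSimpleRing A] [IsArtinianRing A] : Prop :=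
  htr k A = fhtr k A ∧ fhtr k A = shtr.{u, v, w} k A ∧ shtr.{u, v, w} k A < ⊤

/-- Smooth simple artinian algebras. -/
def IsSmooth [IsSimpleRing A] [IsArtinianRing A] : Prop :=
  projectiveDimension (diagonal k A) < ⊤

/-- Rigid simple artinian algebras: `Ext` of `A` into `A ⊗ Aᵒᵖ` is concentrated in one degree `n`,
where it is isomorphic, as a bimodule, to `A^σ` for some automorphism `σ`. -/
def IsRigid [IsSimpleRing A] [IsArtinianRing A] : Prop :=
  ∃ (n : ℕ) (σ : A ≃ₐ[k] A), Nonempty (extBimodule k A n ≅ twisted k σ) ∧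
    ∀ i : ℕ, i ≠ n → Subsingleton (Abelian.Ext (diagonal k A) (envSelf k A) i)

end HomTr

end

/-!
As `F` has countable dimension, its tensor product `F ⊗ U` with a semisimple algebra `U` is the
union of an increasing sequence of subrings, the images of `G ⊗ U` for finite subextensions `G`.
They are semisimple, since the separability idempotent of `G` averages `U`-linear sections to
`G ⊗ U`-linear ones, as in Maschke's theorem. Hence every left ideal of `F ⊗ U` is the union of the
left ideals generated by an increasing sequence of idempotents `e n`. It is therefore the direct sum
of the left ideals generated by `e 0` and by the differences `e (n + 1) - e n`, hence projective,
and so the dimensions in question are at most `1`.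

The kernel `J` of the multiplication map `F ⊗ Fᵒᵖ → F` is not finitely generated: an idempotent
generator `e` would yield a nonzero element `1 - e` on which both actions of `F` agree, and this
forces `F` to be finite over `k`. A sequence `a` in `F` defines a homomorphism `J → F ⊗ Fᵒᵖ`,
multiplication by `1 ⊗ a n` on the summand generated by `e (n + 1) - e n`. It extends to `F ⊗ Fᵒᵖ`
only if `a` is eventually constant, so that `Ext¹(F, F ⊗ Fᵒᵖ)` is infinite dimensional over `F`.
-/

namespace HomTr

section Averaging

open Algebra.FormallyUnramified

variable (k G : Type*) [CommRing k] [CommRing G] [Algebra k G]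
  [Algebra.FormallyUnramified k G] [Algebra.EssFiniteType k G]
  {M N M' N' : Type*} [AddCommGroup M] [AddCommGroup N] [AddCommGroup M'] [AddCommGroup N']
  [Module k M] [Module k N] [Module k M'] [Module k N']
  [Module G M] [Module G N] [Module G M'] [Module G N']
  [IsScalarTower k G M] [IsScalarTower k G N] [IsScalarTower k G M'] [IsScalarTower k G N']

/-- The `G`-linear average `m ↦ ∑ gᵢ φ (hᵢ m)` of a `k`-linear map `φ` between `G`-modules, where
`∑ gᵢ ⊗ hᵢ` is the separability idempotent of `G` over `k`. It turns `k`-linear sections into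
`G`-linear ones, as averaging over a finite group does in Maschke's theorem. -/
noncomputable def average (φ : M →ₗ[k] N) : M →ₗ[G] N :=
  TensorProduct.AlgebraTensorModule.lift
    ((Algebra.lsmul G G N).toLinearMap.flip.restrictScalars k).flip ∘ₗ φ.baseChange G ∘ₗ sec k G M

lemma average_eq_sum {s : Finset (G × G)} (hs : elem k G = ∑ i ∈ s, i.1 ⊗ₜ[k] i.2)
    (φ : M →ₗ[k] N) (m : M) : average k G φ m = ∑ i ∈ s, i.1 • φ (i.2 • m) := by
  simp [average, sec, hs]

lemma average_id : average k G (LinearMap.id : M →ₗ[k] M) = LinearMap.id := by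
  rw [average, LinearMap.baseChange_id, LinearMap.id_comp, comp_sec]

variable {k G} in
lemma average_naturality {φ : M →ₗ[k] N} {φ' : M' →ₗ[k] N'} {α : M →ₗ[G] M'} {β : N →ₗ[G] N'}
    (h : ∀ m, φ' (α m) = β (φ m)) (m : M) : average k G φ' (α m) = β (average k G φ m) := by
  obtain ⟨s, hs⟩ := TensorProduct.exists_finset (elem k G)
  simp only [average_eq_sum k G hs, map_sum, map_smul, ← h]

end Averaging

section Semisimple

variable {k G R : Type*} [CommRing k] [CommRing G] [Algebra k G]
  [Algebra.FormallyUnramified k G] [Algebra.EssFiniteType k G]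
  [Ring R] [Algebra k R] [Algebra G R] [IsScalarTower k G R]

lemma isSemisimpleRing_of_formallyUnramified (B : Subalgebra k R) [IsSemisimpleRing B]
    (hB : Submodule.span G (B : Set R) = ⊤) : IsSemisimpleRing R := by
  refine (isSemisimpleModule_iff R R).2 ⟨fun I ↦ ?_⟩
  obtain ⟨p, hp⟩ := IsSemisimpleModule.extension_property (I.restrictScalars B).subtype
    Subtype.val_injective LinearMap.id
  let p' : R →ₗ[k] I := p.restrictScalars k
  have hid (x : I) : average k G p' x = x := by
    have := average_naturality (φ := .id) (φ' := p') (α := I.subtype.restrictScalars G) (β := .id)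
      (LinearMap.congr_fun hp) x
    rwa [average_id] at this
  have hmulB (b : B) (x : R) : average k G p' (b * x) = (b : R) • average k G p' x :=
    average_naturality (α := LinearMap.mulLeft G (b : R)) (β := (Module.toModuleEnd G (S := R) I b))
      (p.map_smul b) x
  have hmul (r x : R) : average k G p' (r * x) = r • average k G p' x := by
    have hr : r ∈ Submodule.span G (B : Set R) := hB ▸ Submodule.mem_top
    induction hr using Submodule.span_induction with
    | mem b hb => exact hmulB ⟨b, hb⟩ x
    | zero => rw [zero_mul, map_zero, zero_smul]
    | add r s _ _ hr hs => rw [add_mul, map_add, hr, hs, add_smul]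
    | smul g r _ hr => rw [smul_mul_assoc, map_smul, hr, smul_assoc]
  exact ⟨_, LinearMap.isCompl_of_proj (f := { average k G p' with map_smul' := hmul }) hid⟩

variable (k G) in
lemma isSemisimpleRing_tensorProduct (U : Type*) [Ring U] [Algebra k U] [IsSemisimpleRing U] :
    IsSemisimpleRing (G ⊗[k] U) := by
  let ι : U →ₐ[k] G ⊗[k] U := Algebra.TensorProduct.includeRight
  have : IsSemisimpleRing ι.range :=
    ι.rangeRestrict.toRingHom.isSemisimpleRing_of_surjective ι.rangeRestrict_surjective
  refine isSemisimpleRing_of_formallyUnramified (G := G) ι.range (eq_top_iff.2 fun x _ ↦ ?_)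
  induction x using TensorProduct.induction_on with
  | zero => exact zero_mem _
  | add x y hx hy => exact add_mem (hx trivial) (hy trivial)
  | tmul g u =>
    rw [← mul_one g, ← smul_eq_mul, ← TensorProduct.smul_tmul']
    exact Submodule.smul_mem _ g (Submodule.subset_span ⟨u, rfl⟩)

lemma isSemisimpleRing_range_map {A : Type*} [Ring A] [Algebra k A] (f : G →ₐ[k] A)
    (U : Type*) [Ring U] [Algebra k U] [IsSemisimpleRing U] :
    IsSemisimpleRing (Algebra.TensorProduct.map f (AlgHom.id k U)).toRingHom.range :=
  have := isSemisimpleRing_tensorProduct k G U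
  RingHom.isSemisimpleRing_of_surjective _ (RingHom.rangeRestrict_surjective _)

end Semisimple

section Exhausting

/-- A sequence of idempotents of `R` that increases in the order `e ≤ f ↔ e * f = e` and exhausts
the left ideal `I`; then `I` is the increasing union of the left ideals `R * e n`. -/
structure IsExhausting {R : Type*} [Ring R] (I : Ideal R) (e : ℕ → R) : Prop where
  mem (n : ℕ) : e n ∈ I
  mul_of_le {m n : ℕ} (h : m ≤ n) : e m * e n = e m
  exists_mul_eq (x : R) (hx : x ∈ I) : ∃ n, x * e n = x

namespace IsExhausting

variable {R : Type*} [Ring R] {I : Ideal R} {e : ℕ → R}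

lemma exists_forall_mul_eq (he : IsExhausting I e) {x : R} (hx : x ∈ I) :
    ∃ N, ∀ n ≥ N, x * e n = x := by
  obtain ⟨N, hN⟩ := he.exists_mul_eq x hx
  exact ⟨N, fun n hn ↦ by rw [← hN, mul_assoc, he.mul_of_le hn]⟩

lemma exists_eq_span_of_fg (he : IsExhausting I e) (hI : I.FG) : ∃ n, I = Ideal.span {e n} := by
  refine Submodule.FG.stabilizes_of_iSup_eq hI ⟨fun n ↦ Ideal.span {e n}, fun m n h ↦ ?_⟩
    (le_antisymm ?_ ?_)
  · exact (Ideal.span_singleton_le_iff_mem _).2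
      (Ideal.mem_span_singleton'.2 ⟨e m, he.mul_of_le h⟩)
  · exact iSup_le fun n ↦ (Ideal.span_singleton_le_iff_mem _).2 (he.mem n)
  · intro x hx
    obtain ⟨n, hn⟩ := he.exists_mul_eq x hx
    exact Submodule.mem_iSup_of_mem n (Ideal.mem_span_singleton'.2 ⟨x, hn⟩)

lemma mul_eq_of_eq_span (he : IsExhausting I e) {n : ℕ} (h : I = Ideal.span {e n}) {x : R}
    (hx : x ∈ I) : x * e n = x := by
  obtain ⟨y, rfl⟩ := Ideal.mem_span_singleton'.1 (h ▸ hx)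
  rw [mul_assoc, he.mul_of_le le_rfl]

lemma exists_isExhausting_ne_succ (he : IsExhausting I e) (hI : ¬ I.FG) :
    ∃ f : ℕ → R, IsExhausting I f ∧ ∀ n, f n ≠ f (n + 1) := by
  have hne (n : ℕ) : ∃ m > n, e n ≠ e m := by
    by_contra! h
    refine hI ⟨{e n}, le_antisymm (Ideal.span_le.2 (by simpa using he.mem n)) fun x hx ↦ ?_⟩
    obtain ⟨N, hN⟩ := he.exists_forall_mul_eq hx
    have hxn : x * e n = x := by
      rw [h (max N (n + 1)) (by lia), hN _ (le_max_left _ _)]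
    simpa using Ideal.mem_span_singleton'.2 ⟨x, hxn⟩
  choose s hs hes using hne
  let φ (n : ℕ) : ℕ := s^[n] 0
  have hφs (n : ℕ) : φ (n + 1) = s (φ n) := Function.iterate_succ_apply' s n 0
  have hφ : StrictMono φ := strictMono_nat_of_lt_succ fun n ↦ hφs n ▸ hs (φ n)
  refine ⟨e ∘ φ, ⟨fun n ↦ he.mem _, fun h ↦ he.mul_of_le (hφ.monotone h), fun x hx ↦ ?_⟩,
    fun n ↦ ?_⟩
  · obtain ⟨N, hN⟩ := he.exists_forall_mul_eq hx
    exact ⟨N, hN _ (hφ.id_le N)⟩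
  · simpa only [Function.comp_apply, hφs] using hes (φ n)

/-- The coordinates `x * (e (n + 1) - e n)` of an element `x` of `I` in the decomposition
`I = R * e 0 ⊕ ⨁ R * (e (n + 1) - e n)`; all but finitely many of them vanish. -/
noncomputable def coords (he : IsExhausting I e) : I →ₗ[R] ℕ →₀ R where
  toFun x := Finsupp.ofSupportFinite (fun n ↦ (x : R) * (e (n + 1) - e n)) <| by
    obtain ⟨N, hN⟩ := he.exists_forall_mul_eq x.2
    refine (Set.finite_lt_nat N).subset fun n hn ↦ (lt_of_not_ge fun h ↦ hn ?_ : n < N)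
    simp only [mul_sub, hN n h, hN (n + 1) (by lia), sub_self]
  map_add' x y := by ext n; exact add_mul _ _ _
  map_smul' r x := by ext n; exact mul_assoc _ _ _

lemma coords_apply (he : IsExhausting I e) (x : I) (n : ℕ) :
    he.coords x n = (x : R) * (e (n + 1) - e n) := rfl

lemma sum_coords_smul_add (he : IsExhausting I e) (x : I) :
    (he.coords x).sum (fun n r ↦ r * e (n + 1)) + x * e 0 = x := by
  obtain ⟨N, hN⟩ := he.exists_forall_mul_eq x.2
  have hsupp : (he.coords x).support ⊆ Finset.range N := fun n hn ↦ by
    by_contra h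
    rw [Finset.mem_range, not_lt] at h
    rw [Finsupp.mem_support_iff, he.coords_apply, mul_sub, hN n h, hN (n + 1) (by lia)] at hn
    exact hn (sub_self _)
  have hterm (n : ℕ) : he.coords x n * e (n + 1) = x * e (n + 1) - x * e n := by
    rw [he.coords_apply, mul_assoc, sub_mul, he.mul_of_le le_rfl, he.mul_of_le n.le_succ, mul_sub]
  rw [Finsupp.sum_of_support_subset _ hsupp (fun n r ↦ r * e (n + 1)) fun n _ ↦ zero_mul _,
    Finset.sum_congr rfl fun n _ ↦ hterm n, Finset.sum_range_sub fun n ↦ (x : R) * e n,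
    sub_add_cancel, hN N le_rfl]

lemma projective (he : IsExhausting I e) : Module.Projective R I := by
  let b (n : ℕ) : I := ⟨e n, he.mem n⟩
  refine Module.Projective.of_split (M := (ℕ →₀ R) × R)
    (he.coords.prod (LinearMap.toSpanSingleton R R (e 0) ∘ₗ I.subtype))
    ((Finsupp.linearCombination R fun n ↦ b (n + 1)).coprod (LinearMap.toSpanSingleton R I (b 0)))
    (LinearMap.ext fun x ↦ Subtype.ext ?_)
  have h0 : e 0 * e 0 = e 0 := he.mul_of_le le_rfl
  simpa [b, Finsupp.linearCombination_apply, Finsupp.sum, mul_assoc, h0] using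
    he.sum_coords_smul_add x

end IsExhausting

end Exhausting

section SigmaSemisimple

/-- A ring is *σ-semisimple* if it is the union of an increasing sequence of semisimple subrings.
Such rings are to semisimple rings what σ-compact spaces are to compact ones. -/
def IsSigmaSemisimple (R : Type*) [Ring R] : Prop :=
  ∃ S : ℕ → Subring R, Monotone S ∧ (∀ n, IsSemisimpleRing (S n)) ∧ ∀ x, ∃ n, x ∈ S n

namespace IsSigmaSemisimple

variable {R : Type*} [Ring R]

lemma exists_isExhausting (hR : IsSigmaSemisimple R) (I : Ideal R) :
    ∃ e : ℕ → R, IsExhausting I e := by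
  obtain ⟨S, hmono, hS, hmem⟩ := hR
  have hunit (n : ℕ) : ∃ e ∈ S n, e ∈ I ∧ ∀ x ∈ S n, x ∈ I → x * e = x := by
    obtain ⟨e, hidem, he⟩ := IsSemisimpleRing.ideal_eq_span_idempotent (I.comap (S n).subtype)
    have heI : e ∈ I.comap (S n).subtype := he ▸ Ideal.mem_span_singleton_self e
    refine ⟨e, e.2, heI, fun x hx hxI ↦ ?_⟩
    have hx' : (⟨x, hx⟩ : S n) ∈ Ideal.span {e} := he ▸ hxI
    obtain ⟨y, hy⟩ := Ideal.mem_span_singleton'.1 hx'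
    have hxe : (⟨x, hx⟩ : S n) * e = ⟨x, hx⟩ := by rw [← hy, mul_assoc, hidem.eq]
    exact congrArg Subtype.val hxe
  choose e heS heI he using hunit
  refine ⟨e, heI, fun {m n} h ↦ he n _ (hmono h (heS m)) (heI m), fun x hx ↦ ?_⟩
  obtain ⟨n, hn⟩ := hmem x
  exact ⟨n, he n x hn hx⟩

lemma isSemisimpleRing (hR : IsSigmaSemisimple R) [IsNoetherianRing R] : IsSemisimpleRing R := by
  refine (isSemisimpleModule_iff R R).2 ⟨fun I ↦ ?_⟩
  obtain ⟨e, he⟩ := hR.exists_isExhausting I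
  obtain ⟨n, hn⟩ := he.exists_eq_span_of_fg (IsNoetherian.noetherian I)
  exact ⟨_, LinearMap.isCompl_of_proj (f := LinearMap.toSpanSingleton R I ⟨e n, he.mem n⟩)
    fun x ↦ Subtype.ext (he.mul_eq_of_eq_span hn x.2)⟩

end IsSigmaSemisimple

end SigmaSemisimple

section Dimension

variable {R : Type v} [Ring R]

/-- A ring is *left hereditary* if all its left ideals are projective. -/
def IsLeftHereditary (R : Type*) [Ring R] : Prop := ∀ I : Ideal R, Module.Projective R I

lemma IsSigmaSemisimple.isLeftHereditary (hR : IsSigmaSemisimple R) : IsLeftHereditary R :=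
  fun I ↦ (hR.exists_isExhausting I).choose_spec.projective

namespace IsLeftHereditary

lemma baer_of_surjective (hR : IsLeftHereditary R) {E Q : Type*} [AddCommGroup E] [Module R E]
    [AddCommGroup Q] [Module R Q] (hE : Module.Baer R E) (q : E →ₗ[R] Q)
    (hq : Function.Surjective q) : Module.Baer R Q := by
  intro I g
  have := hR I
  obtain ⟨l, rfl⟩ := Module.projective_lifting_property q g hq
  obtain ⟨l', hl'⟩ := hE I l
  exact ⟨q ∘ₗ l', fun x hx ↦ congrArg q (hl' x hx)⟩

lemma hasInjectiveDimensionLT_two (hR : IsLeftHereditary R) (N : ModuleCat.{v} R) :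
    HasInjectiveDimensionLT N 2 := by
  let ⟨E, _, f, _⟩ := EnoughInjectives.presentation N
  have hf : Function.Injective f.hom := (ModuleCat.mono_iff_injective f).1 ‹_›
  let S : ShortComplex (ModuleCat.{v} R) :=
    ModuleCat.shortComplexOfCompEqZero _ _ f.hom.exact_map_mkQ_range.linearMap_comp_eq_zero
  have hS : S.ShortExact := ModuleCat.shortComplex_shortExact S
    f.hom.exact_map_mkQ_range hf (Submodule.mkQ_surjective _)
  have : Module.Injective R E := Module.injective_module_of_injective_object R E
  have hQ : Module.Baer R (E ⧸ f.hom.range) :=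
    hR.baer_of_surjective (Module.Baer.of_injective ‹_›) _ (Submodule.mkQ_surjective _)
  have : Injective S.X₂ := ‹Injective E›
  have : Injective S.X₃ := (Module.injective_iff_injective_object R _).1 hQ.injective
  exact hS.hasInjectiveDimensionLT_X₁ 1 inferInstance inferInstance

lemma injdim_le_one (hR : IsLeftHereditary R) : injdim R ≤ 1 :=
  (injectiveDimension_le_iff _ 1).2 (hR.hasInjectiveDimensionLT_two _)

lemma projectiveDimension_le_one (hR : IsLeftHereditary R) (M : ModuleCat.{v} R) :
    projectiveDimension M ≤ 1 :=
  (projectiveDimension_le_iff M 1).2 <| .mk fun _ hi Y ξ ↦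
    have := hR.hasInjectiveDimensionLT_two Y
    ξ.eq_zero_of_hasInjectiveDimensionLT 2 hi

lemma gldim_le_one (hR : IsLeftHereditary R) : gldim R ≤ 1 :=
  iSup_le hR.projectiveDimension_le_one

end IsLeftHereditary

lemma zero_le_injdim [Nontrivial R] : 0 ≤ injdim R := by
  refine (injectiveDimension_ge_iff _ 0).2 fun h ↦ ?_
  have := (hasInjectiveDimensionLT_zero_iff_isZero _).1 h
  exact not_subsingleton R (ModuleCat.isZero_iff_subsingleton.1 this)

lemma injdim_eq_zero [IsSemisimpleRing R] [Nontrivial R] : injdim R = 0 := by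
  refine le_antisymm ((injectiveDimension_le_iff _ 0).2 ?_) zero_le_injdim
  have : Injective (ModuleCat.of R R) :=
    (Module.injective_iff_injective_object R R).1 (Module.injective_of_isSemisimpleRing R R)
  infer_instance

attribute [local instance] RingHomInvPair.of_ringEquiv in
lemma injdim_eq_of_ringEquiv {S : Type w} [Ring S] (e : R ≃+* S) : injdim R = injdim S :=
  ModuleCat.injectiveDimension_eq_of_semiLinearEquiv e (M := ModuleCat.of R R)
    (N := ModuleCat.of S S) e.toSemilinearEquiv

lemma projectiveDimension_le_gldim (M : ModuleCat.{v} R) : projectiveDimension M ≤ gldim R :=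
  le_iSup (fun M : ModuleCat.{v} R ↦ projectiveDimension M) M

end Dimension

section Degrees

variable (k : Type u) [Field k]

lemma fhtr_le_projectiveDimension_diagonal (A : Type v) [Ring A] [Algebra k A] :
    fhtr k A ≤ projectiveDimension (diagonal k A) :=
  iSup₂_le fun i _ ↦ (projectiveDimension_ge_iff _ i).2 fun h ↦
    not_subsingleton _ (h.subsingleton _ i i le_rfl (envSelf k A))

lemma fhtr_le_htr (A : Type v) [Ring A] [Algebra k A] : fhtr k A ≤ htr k A :=
  iSup₂_le fun i _ ↦ (injectiveDimension_ge_iff _ i).2 fun h ↦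
    not_subsingleton _ (h.subsingleton _ i i le_rfl (diagonal k A))

lemma injdim_tensorProduct_le_shtr (A : Type v) [Ring A] [Algebra k A] (U : Type w)
    [DivisionRing U] [Algebra k U] : injdim (A ⊗[k] U) ≤ shtr.{u, v, w} k A :=
  le_iSup_of_le U (le_iSup₂_of_le inferInstance inferInstance le_rfl)

lemma htr_le_shtr (D : Type v) [DivisionRing D] [Algebra k D] :
    htr k D ≤ shtr.{u, v, max v w} k D := by
  let ε : D ⊗[k] ULift.{w} Dᵐᵒᵖ ≃ₐ[k] Env k D :=
    Algebra.TensorProduct.congr AlgEquiv.refl ULift.algEquiv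
  rw [htr, ← injdim_eq_of_ringEquiv ε.toRingEquiv]
  exact injdim_tensorProduct_le_shtr k D _

lemma thtr_nonneg (A : Type v) [Ring A] [Algebra k A] [Nontrivial A]
    (hA : IsNoetherianBothSides A) : 0 ≤ thtr.{u, v, max u w} k A := by
  let ε : A ⊗[k] ULift.{max u w} k ≃ₐ[k] A :=
    (Algebra.TensorProduct.congr AlgEquiv.refl ULift.algEquiv).trans
      (Algebra.TensorProduct.rid k k A)
  have h : IsNoetherianBothSides (A ⊗[k] ULift.{max u w} k) :=
    have := hA.1
    have := hA.2
    ⟨isNoetherianRing_of_ringEquiv A ε.symm.toRingEquiv,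
      isNoetherianRing_of_ringEquiv Aᵐᵒᵖ (RingEquiv.op ε.symm.toRingEquiv)⟩
  have := ε.toEquiv.nontrivial
  exact zero_le_injdim.trans (le_iSup_of_le (ULift.{max u w} k)
    (le_iSup₂_of_le inferInstance inferInstance (le_iSup_of_le h le_rfl)))

end Degrees

section TensorProduct

variable (k : Type*) {F : Type*} [Field k] [Field F] [Algebra k F]

lemma exists_monotone_finiteDimensional [Algebra.IsAlgebraic k F]
    (hF : Module.rank k F ≤ Cardinal.aleph0) :
    ∃ G : ℕ → IntermediateField k F, Monotone G ∧ (∀ n, FiniteDimensional k (G n)) ∧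
      ∀ x, ∃ n, x ∈ G n := by
  let b := Module.Basis.ofVectorSpace k F
  have : Countable (Module.Basis.ofVectorSpaceIndex k F) := by
    rwa [← Cardinal.mk_le_aleph0_iff, b.mk_eq_rank'']
  obtain ⟨i, hi⟩ := exists_injective_nat (Module.Basis.ofVectorSpaceIndex k F)
  let G (n : ℕ) : IntermediateField k F := IntermediateField.adjoin k (b '' (i ⁻¹' Set.Iio n))
  refine ⟨G, fun m n h ↦ ?_, fun n ↦ ?_, fun x ↦ ?_⟩
  · exact IntermediateField.adjoin.mono k _ _
      (Set.image_mono (Set.preimage_mono (Set.Iio_subset_Iio h)))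
  · have := (((Set.finite_Iio n).preimage hi.injOn).image b).to_subtype
    exact IntermediateField.finiteDimensional_adjoin fun x _ ↦ Algebra.IsIntegral.isIntegral x
  · obtain ⟨n, hn⟩ := ((b.repr x).support.image i).bddAbove
    have hsupp : b '' (b.repr x).support ⊆ G (n + 1) := by
      rintro _ ⟨j, hj, rfl⟩
      exact IntermediateField.subset_adjoin k _
        ⟨j, Nat.lt_succ_of_le (hn (Finset.mem_image_of_mem i hj)), rfl⟩
    exact ⟨n + 1, Submodule.span_le (p := (G (n + 1)).toSubalgebra.toSubmodule).2 hsupp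
      (b.mem_span_repr_support x)⟩

lemma isSigmaSemisimple_tensorProduct [Algebra.IsSeparable k F]
    (hF : Module.rank k F ≤ Cardinal.aleph0) (U : Type*) [Ring U] [Algebra k U]
    [IsSemisimpleRing U] : IsSigmaSemisimple (F ⊗[k] U) := by
  obtain ⟨G, hmono, hfin, hmem⟩ := exists_monotone_finiteDimensional k hF
  let ι (n : ℕ) : G n ⊗[k] U →ₐ[k] F ⊗[k] U := Algebra.TensorProduct.map (G n).val (.id k U)
  have hι : Monotone fun n ↦ (ι n).toRingHom.range := by
    rintro m n h _ ⟨x, rfl⟩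
    have hmn : (ι n).comp (Algebra.TensorProduct.map (IntermediateField.inclusion (hmono h))
        (.id k U)) = ι m := by
      ext <;> simp [ι]
    exact ⟨_, DFunLike.congr_fun hmn x⟩
  refine ⟨_, hι, fun n ↦ ?_, fun x ↦ ?_⟩
  · have := Algebra.FormallyUnramified.of_isSeparable k (G n)
    exact isSemisimpleRing_range_map (G n).val U
  · induction x using TensorProduct.induction_on with
    | zero => exact ⟨0, zero_mem _⟩
    | tmul a u =>
      obtain ⟨n, hn⟩ := hmem a
      exact ⟨n, (⟨a, hn⟩ : G n) ⊗ₜ u, rfl⟩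
    | add x y hx hy =>
      obtain ⟨m, hm⟩ := hx
      obtain ⟨n, hn⟩ := hy
      exact ⟨max m n, add_mem (hι (le_max_left m n) hm) (hι (le_max_right m n) hn)⟩

end TensorProduct

lemma not_finite_of_eventuallyConst_of_map_eq_zero {K E : Type*} [DivisionRing K]
    [AddCommGroup E] [Module K E] (Ψ : (ℕ → K) →ₗ[K] E)
    (hΨ : ∀ a, Ψ a = 0 → Filter.EventuallyConst a Filter.atTop) : ¬ Module.Finite K E := by
  intro hE
  -- `T a` takes the value `0` and each value of `a` infinitely often
  let T : (ℕ → K) →ₗ[K] ℕ → K :=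
    LinearMap.pi fun n ↦ if n.unpair.2 = 0 then 0 else LinearMap.proj n.unpair.1
  have hT0 (a : ℕ → K) (m : ℕ) : T a (Nat.pair m 0) = 0 := by simp [T]
  have hT (a : ℕ → K) (m n : ℕ) : T a (Nat.pair m (n + 1)) = a m := by simp [T]
  have hinj : Function.Injective (Ψ ∘ₗ T) := by
    refine (injective_iff_map_eq_zero _).2 fun a ha ↦ funext fun m ↦ ?_
    obtain ⟨N, hN⟩ := Filter.eventuallyConst_atTop.1 (hΨ (T a) ha)
    calc a m = T a (Nat.pair m (N + 1)) := (hT a m N).symm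
      _ = T a N := hN _ (N.le_succ.trans (Nat.right_le_pair _ _))
      _ = T a (Nat.pair N 0) := (hN _ (Nat.left_le_pair _ _)).symm
      _ = 0 := hT0 a N
  have : Module.Finite K (ℕ → K) := .of_injective _ hinj
  have : Module.Finite K (ℕ →₀ K) :=
    .of_injective (Finsupp.lcoeFun : (ℕ →₀ K) →ₗ[K] ℕ → K) DFunLike.coe_injective
  have := (Module.finite_finsupp_self_iff.1 this).resolve_left (not_subsingleton K)
  exact not_finite ℕ

section Gluing

namespace IsExhausting

/-- The homomorphism on the left ideal `I = R * e 0 ⊕ ⨁ R * (e (n + 1) - e n)` that is zero on the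
first summand and right multiplication by `f n` on the summand `R * (e (n + 1) - e n)`. -/
noncomputable def glue {R : Type*} [Ring R] {I : Ideal R} {e : ℕ → R} (he : IsExhausting I e)
    (f : ℕ → R) : I →ₗ[R] R :=
  Finsupp.linearCombination R f ∘ₗ he.coords

section Ring

variable {R : Type*} [Ring R] {I : Ideal R} {e : ℕ → R} (he : IsExhausting I e)

lemma glue_add (f g : ℕ → R) : he.glue (f + g) = he.glue f + he.glue g := by
  ext x
  simp [glue, Finsupp.linearCombination_apply, mul_add, Finsupp.sum_add]

lemma glue_mul_right (f : ℕ → R) (r : R) (x : I) :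
    he.glue (fun n ↦ f n * r) x = he.glue f x * r := by
  simp [glue, Finsupp.linearCombination_apply, Finsupp.sum_mul, mul_assoc]

end Ring

variable {R : Type*} [CommRing R] {I : Ideal R} {e : ℕ → R}

lemma mul_eq_min (he : IsExhausting I e) (m n : ℕ) : e m * e n = e (min m n) := by
  rcases le_total m n with h | h
  · rw [he.mul_of_le h, min_eq_left h]
  · rw [mul_comm, he.mul_of_le h, min_eq_right h]

lemma sub_mul_sub (he : IsExhausting I e) {m n : ℕ} (h : m ≠ n) :
    (e (m + 1) - e m) * (e (n + 1) - e n) = 0 := by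
  simp only [sub_mul, mul_sub, he.mul_eq_min]
  rcases h.lt_or_gt with h | h
  · simp [h.le, Nat.succ_le_of_lt h, (Nat.lt_succ_of_lt h).le]
  · simp [h.le, Nat.succ_le_of_lt h, (Nat.lt_succ_of_lt h).le]

lemma sub_mul_self (he : IsExhausting I e) (n : ℕ) :
    (e (n + 1) - e n) * (e (n + 1) - e n) = e (n + 1) - e n := by
  simp [sub_mul, mul_sub, he.mul_eq_min]

lemma coords_sub (he : IsExhausting I e) (n : ℕ) :
    he.coords (⟨e (n + 1), he.mem _⟩ - ⟨e n, he.mem _⟩) = Finsupp.single n (e (n + 1) - e n) := by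
  ext m
  rw [he.coords_apply, Submodule.coe_sub, Finsupp.single_apply]
  split_ifs with h
  · rw [← h, he.sub_mul_self]
  · exact he.sub_mul_sub h

lemma glue_sub (he : IsExhausting I e) (f : ℕ → R) (n : ℕ) :
    he.glue f (⟨e (n + 1), he.mem _⟩ - ⟨e n, he.mem _⟩) = (e (n + 1) - e n) * f n := by
  rw [glue, LinearMap.comp_apply, he.coords_sub, Finsupp.linearCombination_single, smul_eq_mul]

lemma sub_mul_eq_of_glue_eq (he : IsExhausting I e) {f : ℕ → R} {g : R →ₗ[R] R}
    (hg : ∀ x : I, g x = he.glue f x) (n : ℕ) :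
    (e (n + 1) - e n) * f n = (e (n + 1) - e n) * g 1 := by
  rw [← he.glue_sub, ← hg, Submodule.coe_sub, ← smul_eq_mul, ← map_smul, smul_eq_mul, mul_one]

end IsExhausting

end Gluing

section Augmentation

variable (k : Type u) [Field k] (F : Type v) [Field F] [Algebra k F]

/-- The multiplication map `F ⊗ Fᵒᵖ → F` as a homomorphism of left modules. -/
noncomputable def augmentation : Env k F →ₗ[Env k F] diagonal k F :=
  LinearMap.toSpanSingleton (Env k F) (diagonal k F) (show F from 1)

/-- The kernel of the multiplication map `F ⊗ Fᵒᵖ → F`; `Ext¹(F, F ⊗ Fᵒᵖ)` is computed from it. -/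
noncomputable def augmentationIdeal : Ideal (Env k F) := LinearMap.ker (augmentation k F)

variable {k F}

lemma augmentation_tmul (a : F) (b : Fᵐᵒᵖ) :
    augmentation k F (a ⊗ₜ b) = (show F from a * b.unop) := by
  let : Module (Env k F) F := TensorProduct.Algebra.module
  change ((a ⊗ₜ[k] b : Env k F) • (1 : F) : F) = _
  rw [TensorProduct.Algebra.smul_def]
  simp [mul_comm]

lemma augmentation_surjective : Function.Surjective (augmentation k F) := fun a ↦
  ⟨(show F from a) ⊗ₜ 1, by rw [augmentation_tmul]; exact mul_one (show F from a)⟩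

lemma tmul_sub_tmul_mem (a : F) :
    (a ⊗ₜ 1 - 1 ⊗ₜ MulOpposite.op a : Env k F) ∈ augmentationIdeal k F := by
  refine LinearMap.sub_mem_ker_iff.2 ?_
  rw [augmentation_tmul, augmentation_tmul]
  exact mul_comm a 1

lemma one_notMem_augmentationIdeal : (1 : Env k F) ∉ augmentationIdeal k F := by
  rw [augmentationIdeal, LinearMap.mem_ker, Algebra.TensorProduct.one_def, augmentation_tmul]
  exact (mul_one (1 : F)).trans_ne (one_ne_zero (α := F))

lemma exists_sub_tmul_mem (r : Env k F) :
    ∃ c : F, r - 1 ⊗ₜ MulOpposite.op c ∈ augmentationIdeal k F := by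
  refine ⟨(show F from augmentation k F r), LinearMap.sub_mem_ker_iff.2 ?_⟩
  rw [augmentation_tmul]
  exact (one_mul (show F from augmentation k F r)).symm

lemma finite_of_tmul_mul_eq {s : Env k F} (hs : s ≠ 0)
    (h : ∀ a : F, (a ⊗ₜ 1) * s = (1 ⊗ₜ MulOpposite.op a) * s) : Module.Finite k F := by
  classical
  let b := Module.Basis.ofVectorSpace k Fᵐᵒᵖ
  let B := Algebra.TensorProduct.basis F b
  obtain ⟨j, hj⟩ : ∃ j, B.coord j s ≠ 0 := by
    by_contra! h
    exact hs (B.forall_coord_eq_zero_iff.1 h)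
  obtain ⟨T, hT⟩ := TensorProduct.exists_finset s
  have hmem (a : F) : B.coord j ((1 ⊗ₜ MulOpposite.op a) * s) ∈
      Submodule.span k (T.image Prod.fst : Set F) := by
    rw [hT, Finset.mul_sum, map_sum]
    refine sum_mem fun i hi ↦ ?_
    rw [Algebra.TensorProduct.tmul_mul_tmul, one_mul, Module.Basis.coord_apply,
      Algebra.TensorProduct.basis_repr_tmul, Finsupp.smul_apply, Finsupp.mapRange_apply,
      smul_eq_mul, mul_comm, ← Algebra.smul_def]
    exact Submodule.smul_mem _ _ (Submodule.subset_span
      (Finset.mem_coe.2 (Finset.mem_image_of_mem _ hi)))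
  have hcoord (a : F) : B.coord j ((a ⊗ₜ 1) * s) = a * B.coord j s := by
    have hsmul : (a ⊗ₜ 1) * s = a • s := (Algebra.smul_def a s).symm
    rw [hsmul, map_smul, smul_eq_mul]
  refine ⟨⟨T.image Prod.fst, top_le_iff.1 fun a _ ↦ ?_⟩⟩
  simpa only [← h, hcoord, div_mul_cancel₀ _ hj] using hmem (a / B.coord j s)

lemma not_fg_augmentationIdeal (hE : IsSigmaSemisimple (Env k F)) (hF : ¬ Module.Finite k F) :
    ¬ (augmentationIdeal k F).FG := by
  intro hJ
  obtain ⟨e, he⟩ := hE.exists_isExhausting (augmentationIdeal k F)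
  obtain ⟨n, hn⟩ := he.exists_eq_span_of_fg hJ
  have hne : 1 - e n ≠ 0 := sub_ne_zero.2 fun h ↦ one_notMem_augmentationIdeal (h ▸ he.mem n)
  refine hF (finite_of_tmul_mul_eq hne fun a ↦ ?_)
  rw [← sub_eq_zero, ← sub_mul, mul_sub, mul_one, he.mul_eq_of_eq_span hn (tmul_sub_tmul_mem a),
    sub_self]

variable (k F) in
/-- The exact sequence `0 → J → F ⊗ Fᵒᵖ → F → 0`, where `J` is the augmentation ideal. -/
noncomputable abbrev augmentationSequence : ShortComplex (ModuleCat.{v} (Env k F)) :=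
  ShortComplex.mk (X₁ := ModuleCat.of (Env k F) (augmentationIdeal k F)) (X₂ := envSelf k F)
    (X₃ := diagonal k F)
    (ModuleCat.ofHom (augmentationIdeal k F).subtype)
    (ModuleCat.ofHom (Y := diagonal k F) (augmentation k F)) (by
      ext x
      exact x.2)

lemma augmentationSequence_shortExact : (augmentationSequence k F).ShortExact :=
  ModuleCat.shortComplex_shortExact _ (LinearMap.exact_subtype_ker_map (augmentation k F))
    Subtype.val_injective augmentation_surjective

section SequenceExt

variable {e : ℕ → Env k F} (he : IsExhausting (augmentationIdeal k F) e)

/-- The class in `Ext¹(F, F ⊗ Fᵒᵖ)` that a sequence `a` in `F` defines: the image, under the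
connecting homomorphism of the augmentation sequence, of the homomorphism on the augmentation ideal
glued from the multiplications by `1 ⊗ a n`. -/
noncomputable def sequenceExt : (ℕ → F) →ₗ[F] extLeftModule k F 1 where
  toFun a := augmentationSequence_shortExact.extClass.comp
    (Abelian.Ext.mk₀ (ModuleCat.ofHom (he.glue fun n ↦ 1 ⊗ₜ MulOpposite.op (a n)))) (add_zero 1)
  map_add' a b := by
    have hglue : he.glue (fun n ↦ 1 ⊗ₜ[k] MulOpposite.op ((a + b) n)) =
        he.glue (fun n ↦ 1 ⊗ₜ MulOpposite.op (a n)) +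
          he.glue (fun n ↦ 1 ⊗ₜ MulOpposite.op (b n)) := by
      rw [← he.glue_add]
      congr 1
      ext n
      exact TensorProduct.tmul_add _ _ _
    rw [hglue, ModuleCat.ofHom_add, Abelian.Ext.mk₀_add, Abelian.Ext.comp_add]
    rfl
  map_smul' c a := by
    have hglue : ModuleCat.ofHom (he.glue fun n ↦ 1 ⊗ₜ[k] MulOpposite.op ((c • a) n)) =
        ModuleCat.ofHom (he.glue fun n ↦ 1 ⊗ₜ[k] MulOpposite.op (a n)) ≫
          rightMul k F (switch k F (c ⊗ₜ 1)) := by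
      ext x
      refine Eq.trans ?_ (he.glue_mul_right _ ((1 : F) ⊗ₜ[k] MulOpposite.op c) x)
      simp [mul_comm]
    rw [hglue, ← Abelian.Ext.mk₀_comp_mk₀, ← Abelian.Ext.comp_assoc_of_second_deg_zero]
    rfl

lemma exists_extension_of_sequenceExt_eq_zero {a : ℕ → F} (ha : sequenceExt he a = 0) :
    ∃ g : Env k F →ₗ[Env k F] Env k F, ∀ x : augmentationIdeal k F,
      g x = he.glue (fun n ↦ 1 ⊗ₜ MulOpposite.op (a n)) x := by
  obtain ⟨y, hy⟩ := Abelian.Ext.contravariant_sequence_exact₁ augmentationSequence_shortExact _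
    (Abelian.Ext.mk₀ (ModuleCat.ofHom (he.glue fun n ↦ 1 ⊗ₜ MulOpposite.op (a n)))) (add_zero 1) ha
  obtain ⟨g, rfl⟩ := Abelian.Ext.homEquiv₀.symm.surjective y
  have hg : (augmentationSequence k F).f ≫ g =
      ModuleCat.ofHom (he.glue fun n ↦ 1 ⊗ₜ MulOpposite.op (a n)) :=
    Abelian.Ext.homEquiv₀.symm.injective (by simpa using hy)
  exact ⟨g.hom, fun x ↦ congrArg (fun φ ↦ φ.hom x) hg⟩

lemma eventuallyConst_of_sequenceExt_eq_zero (hne : ∀ n, e n ≠ e (n + 1)) {a : ℕ → F}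
    (ha : sequenceExt he a = 0) : Filter.EventuallyConst a Filter.atTop := by
  obtain ⟨g, hg⟩ := exists_extension_of_sequenceExt_eq_zero he ha
  obtain ⟨c, hc⟩ := exists_sub_tmul_mem (g 1)
  obtain ⟨N, hN⟩ := he.exists_forall_mul_eq hc
  have hac (n : ℕ) (hn : N ≤ n) : a n = c := by
    have h0 : (e (n + 1) - e n) * 1 ⊗ₜ MulOpposite.op (a n - c) = 0 :=
      calc (e (n + 1) - e n) * 1 ⊗ₜ MulOpposite.op (a n - c)
          = (e (n + 1) - e n) * (1 ⊗ₜ MulOpposite.op (a n) - 1 ⊗ₜ MulOpposite.op c) := by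
            rw [MulOpposite.op_sub, TensorProduct.tmul_sub]
        _ = (g 1 - 1 ⊗ₜ MulOpposite.op c) * (e (n + 1) - e n) := by
            rw [mul_sub, he.sub_mul_eq_of_glue_eq hg, ← mul_sub, mul_comm]
        _ = 0 := by rw [mul_sub, hN n hn, hN (n + 1) (by lia), sub_self]
    by_contra h
    have hunit : IsUnit ((1 : F) ⊗ₜ[k] MulOpposite.op (a n - c)) :=
      (IsUnit.mk0 _ (sub_ne_zero.2 h)).op.map
        (Algebra.TensorProduct.includeRight : Fᵐᵒᵖ →ₐ[k] Env k F)
    exact sub_ne_zero.2 (hne n).symm (hunit.mul_left_eq_zero.1 h0)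
  exact Filter.eventuallyConst_atTop.2 ⟨N, fun n hn ↦ (hac n hn).trans (hac N le_rfl).symm⟩

end SequenceExt

lemma not_finite_extLeftModule_one (hE : IsSigmaSemisimple (Env k F))
    (hF : ¬ Module.Finite k F) : ¬ Module.Finite F (extLeftModule k F 1) := by
  obtain ⟨e, he⟩ := hE.exists_isExhausting (augmentationIdeal k F)
  obtain ⟨f, hf, hne⟩ := he.exists_isExhausting_ne_succ (not_fg_augmentationIdeal hE hF)
  exact not_finite_of_eventuallyConst_of_map_eq_zero (sequenceExt hf) fun _ ↦
    eventuallyConst_of_sequenceExt_eq_zero hf hne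

end Augmentation

section Twisted

variable (k : Type u) [Field k] {A : Type v} [Ring A] [Algebra k A]

lemma tmul_one_smul_twisted (σ : A ≃ₐ[k] A) (a x : A) :
    ((a ⊗ₜ[k] (1 : Aᵐᵒᵖ) : Env k A) • (show twisted k σ from x) : twisted k σ) =
      (show twisted k σ from a * x) := by
  change ((Algebra.TensorProduct.map (AlgHom.id k A) (AlgHom.op σ.toAlgHom)
    (a ⊗ₜ[k] (1 : Aᵐᵒᵖ)) : Env k A) • (show diagonal k A from x) : diagonal k A) = _
  rw [Algebra.TensorProduct.map_tmul, map_one]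
  let : Module (Env k A) A := TensorProduct.Algebra.module
  change ((a ⊗ₜ[k] (1 : Aᵐᵒᵖ) : Env k A) • x : A) = a * x
  rw [TensorProduct.Algebra.smul_def]
  simp

lemma finite_restrictScalars_twisted (σ : A ≃ₐ[k] A) :
    Module.Finite A ((ModuleCat.restrictScalars
      (Algebra.TensorProduct.includeLeft : A →ₐ[k] Env k A).toRingHom).obj (twisted k σ)) :=
  .of_surjective (M := A)
    ({ toFun := fun x ↦ x
       map_add' := fun _ _ ↦ rfl
       map_smul' := fun a x ↦ (tmul_one_smul_twisted k σ a x).symm } :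
      A →ₗ[A] (ModuleCat.restrictScalars
        (Algebra.TensorProduct.includeLeft : A →ₐ[k] Env k A).toRingHom).obj (twisted k σ))
    Function.surjective_id

end Twisted

section CountableExtension

variable {k : Type u} [Field k] {F : Type v} [Field F] [Algebra k F]

lemma htr_eq_zero_of_finite [FiniteDimensional k F] [Algebra.IsSeparable k F] : htr k F = 0 := by
  have := Algebra.FormallyUnramified.of_isSeparable k F
  have := isSemisimpleRing_tensorProduct k F Fᵐᵒᵖ
  exact injdim_eq_zero

lemma nontrivial_ext_one (hE : IsSigmaSemisimple (Env k F)) (hF : ¬ Module.Finite k F) :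
    Nontrivial (Abelian.Ext (diagonal k F) (envSelf k F) 1) := by
  by_contra h
  have : Subsingleton (extLeftModule k F 1) := not_nontrivial_iff_subsingleton.1 h
  exact not_finite_extLeftModule_one hE hF inferInstance

lemma one_le_fhtr (hE : IsSigmaSemisimple (Env k F)) (hF : ¬ Module.Finite k F) : 1 ≤ fhtr k F :=
  le_iSup₂_of_le 1 (nontrivial_ext_one hE hF) le_rfl

lemma htr_eq_one (hE : IsSigmaSemisimple (Env k F)) (hF : ¬ Module.Finite k F) : htr k F = 1 :=
  le_antisymm hE.isLeftHereditary.injdim_le_one ((one_le_fhtr hE hF).trans (fhtr_le_htr k F))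

lemma fhtr_eq_one (hE : IsSigmaSemisimple (Env k F)) (hF : ¬ Module.Finite k F) : fhtr k F = 1 :=
  le_antisymm ((fhtr_le_htr k F).trans (htr_eq_one hE hF).le) (one_le_fhtr hE hF)

lemma gldim_env_eq_one (hE : IsSigmaSemisimple (Env k F)) (hF : ¬ Module.Finite k F) :
    gldim (Env k F) = 1 :=
  le_antisymm hE.isLeftHereditary.gldim_le_one <| (one_le_fhtr hE hF).trans <|
    (fhtr_le_projectiveDimension_diagonal k F).trans (projectiveDimension_le_gldim _)

lemma shtr_eq_one [Algebra.IsSeparable k F] (hdim : Module.rank k F = Cardinal.aleph0) :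
    shtr.{u, v, max v w} k F = 1 := by
  have hU (U : Type (max v w)) [DivisionRing U] [Algebra k U] : injdim (F ⊗[k] U) ≤ 1 :=
    (isSigmaSemisimple_tensorProduct k hdim.le U).isLeftHereditary.injdim_le_one
  have hF : ¬ Module.Finite k F := fun _ ↦ (Module.rank_lt_aleph0 k F).ne hdim
  refine le_antisymm (iSup_le fun U ↦ iSup₂_le fun _ _ ↦ hU U) ?_
  rw [← htr_eq_one (isSigmaSemisimple_tensorProduct k hdim.le Fᵐᵒᵖ) hF]
  exact htr_le_shtr.{u, v, w} k F

lemma thtr_eq_zero [Algebra.IsSeparable k F] (hF : Module.rank k F ≤ Cardinal.aleph0) :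
    thtr.{u, v, max u w} k F = 0 := by
  have hU (U : Type (max u w)) [DivisionRing U] [Algebra k U] [IsNoetherianRing (F ⊗[k] U)] :
      injdim (F ⊗[k] U) = 0 :=
    have := (isSigmaSemisimple_tensorProduct k hF U).isSemisimpleRing
    injdim_eq_zero
  refine le_antisymm (iSup_le fun U ↦ iSup₂_le fun _ _ ↦ iSup_le fun h ↦ ?_)
    (thtr_nonneg k F ⟨inferInstance, inferInstance⟩)
  have := h.1
  exact (hU U).le

lemma not_isDoublyNoetherian (hE : IsSigmaSemisimple (Env k F)) (hF : ¬ Module.Finite k F) :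
    ¬ IsDoublyNoetherian k F := fun h ↦
  have := h.1
  not_fg_augmentationIdeal hE hF (IsNoetherian.noetherian _)

lemma not_isRigid (hE : IsSigmaSemisimple (Env k F)) (hF : ¬ Module.Finite k F) :
    ¬ IsRigid k F := by
  rintro ⟨n, σ, ⟨ε⟩, h⟩
  have := nontrivial_ext_one hE hF
  obtain rfl : 1 = n := by_contra fun hn ↦ not_subsingleton _ (h 1 hn)
  let ε' := ((ModuleCat.restrictScalars
    (Algebra.TensorProduct.includeLeft : F →ₐ[k] Env k F).toRingHom).mapIso ε).toLinearEquiv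
  have := finite_restrictScalars_twisted k σ
  exact not_finite_extLeftModule_one hE hF (.equiv ε'.symm)

end CountableExtension

end HomTr

theorem proposition7p1 (k : Type u) (F : Type v) [Field k] [Field F] [Algebra k F]
    (hsep : Algebra.IsSeparable k F) (hdim : Module.rank k F = Cardinal.aleph0) :
    (HomTr.IsSmooth k F ∧ HomTr.IsHomologicallyUniform.{u, v, max u v w} k F ∧
      HomTr.htr k F = 1 ∧ HomTr.gldim (F ⊗[k] Fᵐᵒᵖ) = 1) ∧
    (¬ HomTr.IsDoublyNoetherian k F ∧
      (∀ G : IntermediateField k F, FiniteDimensional k G → HomTr.htr k G = 0) ∧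
      (⨆ (G : IntermediateField k F) (_ : FiniteDimensional k G), HomTr.htr k G) = 0) ∧
    (HomTr.thtr.{u, v, max u v w} k F = 0 ∧ Algebra.trdeg k F = 0) ∧
    (¬ HomTr.IsRigid k F ∧ ¬ Module.Finite F (HomTr.extLeftModule k F 1)) := by
  have hfin : ¬ Module.Finite k F := fun _ ↦ (Module.rank_lt_aleph0 k F).ne hdim
  have hE := HomTr.isSigmaSemisimple_tensorProduct k hdim.le Fᵐᵒᵖ
  have hG (G : IntermediateField k F) (_ : FiniteDimensional k G) : HomTr.htr k G = 0 :=
    HomTr.htr_eq_zero_of_finite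
  refine ⟨⟨?smooth, ?uniform, HomTr.htr_eq_one hE hfin, HomTr.gldim_env_eq_one hE hfin⟩,
    ⟨HomTr.not_isDoublyNoetherian hE hfin, hG, ?sup⟩,
    ⟨HomTr.thtr_eq_zero.{u, v, max v w} hdim.le, trdeg_eq_zero⟩,
    HomTr.not_isRigid hE hfin, HomTr.not_finite_extLeftModule_one hE hfin⟩
  case smooth =>
    exact (hE.isLeftHereditary.projectiveDimension_le_one _).trans_lt (by decide)
  case uniform =>
    rw [HomTr.IsHomologicallyUniform, HomTr.htr_eq_one hE hfin, HomTr.fhtr_eq_one hE hfin,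
      HomTr.shtr_eq_one.{u, v, max u w} hdim]
    exact ⟨rfl, rfl, by decide⟩
  case sup =>
    exact le_antisymm (iSup₂_le fun G hGfin ↦ (hG G hGfin).le)
      (le_iSup₂_of_le ⊥ inferInstance (hG ⊥ inferInstance).ge)
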